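/- Let $\varphi(q)=\sum_{k=-\infty}^{\infty}q^{k^2}$, and define the formal power series $$F(q)=\frac{\varphi(-q^3)}{\varphi(-q)},\qquad \gamma=\gamma(q)=\frac{F(q)}{F(q^9)},\qquad \xi=\xi(q)=\frac{\varphi(-q^9)}{\varphi(-q)}.$$ Let $U$ be the operator $U\big(\sum_{n\ge 0} a_nq^n\big)=\sum_{n\ge 0} a_{3n}q^n$. Theorem 2.1. For every integer $i\ge 0$, both $U(\xi^i)$ and $U(\gamma\xi^i)$ can be expressed as polynomials in $\xi$ with integer coefficients, that is, both lie in $\mathbb{Z}[\xi]$. Moreover, whenever $U(\xi^i)=\sum_{j\ge 0}X_i(j)\,\xi^j$ with integers $X_i(j)$, all but finitely many of them zero, one has $X_i(j)=0$ for all $0\le j<\lceil i/3\rceil$. -/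

import Mathlib

open PowerSeries

noncomputable section

namespace RamanujanTheta

/-- The formal power series `φ(q) = ∑_{k ∈ ℤ} q ^ (k ^ 2)`: the coefficient of `q ^ n` is the number
of integers `k` with `k ^ 2 = n`. -/
def phi : ℚ⟦X⟧ :=
  PowerSeries.mk fun n => (({k : ℤ | k ^ 2 = (n : ℤ)}.ncard : ℕ) : ℚ)

/-- The series `φ(-q)`. -/
def phiNeg : ℚ⟦X⟧ :=
  rescale (-1 : ℚ) phi

/-- The series `F(q) = φ(-q ^ 3) / φ(-q)`. -/
def F : ℚ⟦X⟧ :=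
  expand 3 (by decide) phiNeg * phiNeg⁻¹

/-- The series `γ(q) = F(q) / F(q ^ 9)`. -/
def gamma : ℚ⟦X⟧ :=
  F * (expand 9 (by decide) F)⁻¹

/-- The series `ξ(q) = φ(-q ^ 9) / φ(-q)`. -/
def xi : ℚ⟦X⟧ :=
  expand 9 (by decide) phiNeg * phiNeg⁻¹

/-- The operator of degree three, `∑ a(n) q ^ n ↦ ∑ a(3 n) q ^ n`. -/
def U (f : ℚ⟦X⟧) : ℚ⟦X⟧ :=
  PowerSeries.mk fun n => coeff (3 * n) f

/-- The constant term of `φ(-q)` is `1`, so the inverse in `F` and `xi` is a genuine one. -/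
theorem constantCoeff_phiNeg : constantCoeff phiNeg = 1 := by
  rw [← coeff_zero_eq_constantCoeff_apply]
  simp [phiNeg, phi]

/-- The constant term of `F(q)` is `1`. -/
theorem constantCoeff_F : constantCoeff F = 1 := by
  simp [F, constantCoeff_phiNeg]

/-- The constant term of `F(q ^ 9)` is `1`, so the inverse in `gamma` is a genuine one. -/
theorem constantCoeff_expand_F : constantCoeff (expand 9 (by decide) F) = 1 := by
  simp [constantCoeff_F]

end RamanujanTheta

end

noncomputable section

namespace RamanujanTheta

/-! Dissect φ(-q) = φ(-q^9) + 2ψ modulo 3: ψ has exponents ≡ 1 and ψ² exponents ≡ 2, so `U` kills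
both. Counting lattice vectors through the tetracode gives φ(-q^3)^4 = φ(-q^9)^4 + 8φ(-q^9)ψ³, that
is `F_pow_four`. With ξ = F(q^3)F(q) this becomes a cubic for ξ over series in q^3 (`xi_pow_three`);
applying `U` gives the recursion `U_xi_pow_add_three`.

As F^4 is a polynomial in ξ divisible by ξ, three steps in i gain one factor ξ. The case of γ
reduces to this by ξ = ξ(q^3)γ, and uniqueness of the coefficients holds because ξ is
transcendental. -/

/-- The generating series of the values of `f`: the coefficient of `q ^ n` is the number of `i` with
`f i = n`. -/
def theta {ι : Type*} (f : ι → ℕ) : ℚ⟦X⟧ :=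
  PowerSeries.mk fun n => (Nat.card {i // f i = n} : ℚ)

/-- Every value of `f` is attained only finitely often. -/
def FiniteFibers {ι : Type*} (f : ι → ℕ) : Prop :=
  ∀ n, Finite {i // f i = n}

/-! ### Algebra of generating series -/

section theta

variable {ι κ : Type*}

theorem coeff_theta (f : ι → ℕ) (n : ℕ) :
    coeff n (theta f) = (Nat.card {i // f i = n} : ℚ) := by
  simp [theta]

theorem theta_equiv {f : ι → ℕ} {g : κ → ℕ} (e : ι ≃ κ) (h : ∀ i, g (e i) = f i) :
    theta f = theta g := by
  ext n
  rw [coeff_theta, coeff_theta]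
  congr 1
  exact Nat.card_congr (e.subtypeEquiv fun i => by rw [h])

/-- The pairs with `f i + g j = n`, sorted by the values of `f` and `g`. -/
def addFiberEquiv (f : ι → ℕ) (g : κ → ℕ) (n : ℕ) :
    {p : ι × κ // f p.1 + g p.2 = n} ≃
      Σ a : Finset.HasAntidiagonal.antidiagonal n, {i // f i = a.1.1} × {j // g j = a.1.2} where
  toFun p := ⟨⟨(f p.1.1, g p.1.2), Finset.HasAntidiagonal.mem_antidiagonal.2 p.2⟩, ⟨p.1.1, rfl⟩, ⟨p.1.2, rfl⟩⟩
  invFun s := ⟨(s.2.1.1, s.2.2.1), by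
    rw [s.2.1.2, s.2.2.2]; exact Finset.HasAntidiagonal.mem_antidiagonal.1 s.1.2⟩
  left_inv _ := rfl
  right_inv := by
    rintro ⟨⟨⟨a, b⟩, h⟩, ⟨i, hi⟩, ⟨j, hj⟩⟩
    dsimp only at hi hj
    subst hi hj
    rfl

theorem FiniteFibers.add {f : ι → ℕ} {g : κ → ℕ} (hf : FiniteFibers f) (hg : FiniteFibers g) :
    FiniteFibers fun p : ι × κ => f p.1 + g p.2 := fun n => by
  have := fun a : Finset.HasAntidiagonal.antidiagonal n => hf a.1.1
  have := fun a : Finset.HasAntidiagonal.antidiagonal n => hg a.1.2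
  exact Finite.of_equiv _ (addFiberEquiv f g n).symm

theorem theta_mul {f : ι → ℕ} {g : κ → ℕ} (hf : FiniteFibers f) (hg : FiniteFibers g) :
    theta f * theta g = theta fun p : ι × κ => f p.1 + g p.2 := by
  ext n
  have := fun a : Finset.HasAntidiagonal.antidiagonal n => hf a.1.1
  have := fun a : Finset.HasAntidiagonal.antidiagonal n => hg a.1.2
  rw [coeff_mul, coeff_theta, Nat.card_congr (addFiberEquiv f g n), Nat.card_sigma]
  push_cast
  rw [← Finset.sum_coe_sort]
  exact Finset.sum_congr rfl fun a _ => by rw [coeff_theta, coeff_theta, Nat.card_prod, Nat.cast_mul]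

theorem theta_prod [Fintype κ] (f : κ → ι → ℕ) (hf : ∀ s, FiniteFibers (f s)) :
    theta (fun p : κ × ι => f p.1 p.2) = ∑ s, theta (f s) := by
  ext n
  have := fun s => hf s n
  rw [map_sum, coeff_theta]
  simp_rw [coeff_theta]
  rw [← Nat.cast_sum, ← Nat.card_sigma]
  congr 1
  exact Nat.card_congr
    { toFun := fun p => ⟨p.1.1, p.1.2, p.2⟩
      invFun := fun s => ⟨(s.1, s.2.1), s.2.2⟩
      left_inv := fun _ => rfl
      right_inv := fun _ => rfl }

theorem expand_theta (f : ι → ℕ) (k : ℕ) (hk : k ≠ 0) :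
    expand k hk (theta f) = theta fun i => k * f i := by
  ext n
  rw [coeff_theta]
  by_cases h : k ∣ n
  · obtain ⟨m, rfl⟩ := h
    rw [coeff_expand_mul, coeff_theta]
    simp [hk]
  · rw [coeff_expand_of_not_dvd _ _ _ h]
    have : IsEmpty {i // k * f i = n} := ⟨fun i => h ⟨_, i.2.symm⟩⟩
    simp

theorem coeff_theta_eq_zero {f : ι → ℕ} {n : ℕ} (h : ∀ i, f i ≠ n) : coeff n (theta f) = 0 := by
  have : IsEmpty {i // f i = n} := ⟨fun i => h _ i.2⟩
  simp [coeff_theta]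

end theta

/-! ### Theta series of residue classes modulo 3 -/

/-- The square of the integer `3 k + c`. -/
def sq3 (c k : ℤ) : ℕ := (3 * k + c).natAbs ^ 2

theorem cast_sq3 (c k : ℤ) : (sq3 c k : ℤ) = (3 * k + c) ^ 2 := by
  simp [sq3]

theorem finiteFibers_natAbs_sq : FiniteFibers fun k : ℤ => k.natAbs ^ 2 := fun n => by
  refine Set.Finite.to_subtype ((Set.finite_Icc (-(n : ℤ)) n).subset fun k hk => ?_)
  have h : k.natAbs ^ 2 = n := hk
  have : k.natAbs ≤ n := h ▸ Nat.le_self_pow two_ne_zero _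
  rw [Set.mem_Icc]
  omega

theorem finiteFibers_sq3 (c : ℤ) : FiniteFibers (sq3 c) := fun n => by
  have := finiteFibers_natAbs_sq n
  refine Finite.of_injective (β := {k : ℤ // k.natAbs ^ 2 = n})
    (fun k => ⟨3 * k.1 + c, k.2⟩) fun k l h => ?_
  have := congrArg Subtype.val h
  ext
  dsimp only at this
  omega

/-- The theta series of the residue class of `c` modulo `3`. -/
def classTheta (c : ℤ) : ℚ⟦X⟧ := theta (sq3 c)

theorem classTheta_neg (c : ℤ) : classTheta (-c) = classTheta c :=
  theta_equiv (Equiv.neg ℤ) fun k => by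
    zify
    rw [cast_sq3, cast_sq3, Equiv.neg_apply]
    ring

theorem classTheta_add_three (c : ℤ) : classTheta (c + 3) = classTheta c :=
  theta_equiv (Equiv.addRight 1) fun k => by
    zify
    rw [cast_sq3, cast_sq3, Equiv.coe_addRight]
    ring

theorem classTheta_neg_one : classTheta (-1) = classTheta 1 := classTheta_neg 1

theorem classTheta_two : classTheta 2 = classTheta 1 := by
  rw [← classTheta_neg_one, ← classTheta_add_three (-1)]; norm_num

theorem classTheta_three : classTheta 3 = classTheta 0 := classTheta_add_three 0

theorem classTheta_four : classTheta 4 = classTheta 1 := classTheta_add_three 1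

theorem phi_eq_theta : phi = theta fun k : ℤ => k.natAbs ^ 2 := by
  ext n
  rw [coeff_theta, phi, coeff_mk, ← Nat.card_coe_set_eq]
  congr 1
  exact Nat.card_congr (Equiv.subtypeEquivRight fun k => by simp [← Int.natCast_inj])

theorem expand_nine_phi : expand 9 (by decide) phi = classTheta 0 := by
  rw [phi_eq_theta, expand_theta]
  exact theta_equiv (Equiv.refl ℤ) fun k => by
    zify
    rw [cast_sq3, Equiv.refl_apply, sq_abs]
    ring

theorem phi_eq_classTheta : phi = classTheta 0 + 2 * classTheta 1 := by
  have h : phi = theta fun p : Fin 3 × ℤ => sq3 (p.1 : ℕ) p.2 := by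
    rw [phi_eq_theta]
    refine (theta_equiv ((Equiv.prodComm _ _).trans (Int.divModEquiv 3).symm) fun p => ?_).symm
    simp [sq3, mul_comm]
  rw [h, theta_prod (fun (s : Fin 3) k => sq3 (s : ℕ) k) fun s => finiteFibers_sq3 _,
    Fin.sum_univ_three]
  change classTheta 0 + classTheta 1 + classTheta 2 = _
  rw [classTheta_two]
  ring

/-! ### The quartic identity from the tetracode -/

theorem theta_mul_four {f₁ f₂ f₃ f₄ : ℤ → ℕ} (h₁ : FiniteFibers f₁) (h₂ : FiniteFibers f₂)
    (h₃ : FiniteFibers f₃) (h₄ : FiniteFibers f₄) :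
    theta f₁ * theta f₂ * (theta f₃ * theta f₄) =
      theta fun p : (ℤ × ℤ) × (ℤ × ℤ) => f₁ p.1.1 + f₂ p.1.2 + (f₃ p.2.1 + f₄ p.2.2) := by
  rw [theta_mul h₁ h₂, theta_mul h₃ h₄, theta_mul (h₁.add h₂) (h₃.add h₄)]

/-- Construction A for the tetracode: the integer vectors whose reduction modulo `3` is a code word
`(s, t, s + t, s - t)` form a lattice with an orthogonal basis of vectors of norm `3`. The coset of
the code word and the quotients by `3` are sent to the coordinates in that basis. -/
def tetracodeEquiv : (Fin 3 × Fin 3) × ((ℤ × ℤ) × (ℤ × ℤ)) ≃ (ℤ × ℤ) × (ℤ × ℤ) where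
  toFun p :=
    let a := (Int.divModEquiv 3).symm (p.2.1.1, p.1.1)
    let b := (Int.divModEquiv 3).symm (p.2.1.2, p.1.2)
    let z := p.2.1.1 + p.2.1.2 - p.2.2.1
    let w := p.2.1.1 - p.2.1.2 - p.2.2.2
    ((a - z - w, b - z + w), (z, w))
  invFun v :=
    let a := Int.divModEquiv 3 (v.1.1 + v.2.2 + v.2.1)
    let b := Int.divModEquiv 3 (v.1.2 - v.2.2 + v.2.1)
    ((a.2, b.2), ((a.1, b.1), (a.1 + b.1 - v.2.1, a.1 - b.1 - v.2.2)))
  left_inv := by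
    rintro ⟨⟨s, t⟩, ⟨x, y⟩, ⟨z, w⟩⟩
    dsimp only
    rw [sub_add_cancel, sub_add_cancel, add_sub_cancel_right, sub_add_cancel,
      Equiv.apply_symm_apply, Equiv.apply_symm_apply]
    simp
  right_inv := by
    rintro ⟨⟨x, y⟩, ⟨z, w⟩⟩
    dsimp only
    rw [Equiv.symm_apply_apply, Equiv.symm_apply_apply]
    ext <;> dsimp only <;> ring

/-- The sum runs over the nine code words: each of the eight nonzero words has exactly one zero
coordinate. -/
theorem expand_three_phi_pow_four : expand 3 (by decide) phi ^ 4 =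
    classTheta 0 ^ 4 + 8 * classTheta 0 * classTheta 1 ^ 3 := by
  have h : expand 3 (by decide) phi ^ 4 = theta fun p : (Fin 3 × Fin 3) × ((ℤ × ℤ) × (ℤ × ℤ)) =>
      sq3 (p.1.1 : ℕ) p.2.1.1 + sq3 (p.1.2 : ℕ) p.2.1.2 +
        (sq3 ((p.1.1 : ℕ) + (p.1.2 : ℕ)) p.2.2.1 + sq3 ((p.1.1 : ℕ) - (p.1.2 : ℕ)) p.2.2.2) := by
    have hf := finiteFibers_natAbs_sq
    rw [← map_pow, show phi ^ 4 = phi * phi * (phi * phi) by ring, phi_eq_theta,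
      theta_mul_four hf hf hf hf, expand_theta]
    refine (theta_equiv tetracodeEquiv ?_).symm
    rintro ⟨⟨s, t⟩, ⟨x, y⟩, ⟨z, w⟩⟩
    zify
    simp only [cast_sq3, tetracodeEquiv, Equiv.coe_fn_mk, Int.divModEquiv_symm_apply, sq_abs]
    push_cast
    ring
  rw [h, theta_prod (fun (s : Fin 3 × Fin 3) (p : (ℤ × ℤ) × (ℤ × ℤ)) =>
      sq3 (s.1 : ℕ) p.1.1 + sq3 (s.2 : ℕ) p.1.2 +
        (sq3 ((s.1 : ℕ) + (s.2 : ℕ)) p.2.1 + sq3 ((s.1 : ℕ) - (s.2 : ℕ)) p.2.2))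
    fun s => ((finiteFibers_sq3 _).add (finiteFibers_sq3 _)).add
      ((finiteFibers_sq3 _).add (finiteFibers_sq3 _))]
  simp_rw [← theta_mul_four (finiteFibers_sq3 _) (finiteFibers_sq3 _) (finiteFibers_sq3 _)
    (finiteFibers_sq3 _)]
  change ∑ s : Fin 3 × Fin 3, classTheta (s.1 : ℕ) * classTheta (s.2 : ℕ) *
    (classTheta ((s.1 : ℕ) + (s.2 : ℕ)) * classTheta ((s.1 : ℕ) - (s.2 : ℕ))) = _
  simp only [Fintype.sum_prod_type, Fin.sum_univ_three, Fin.val_zero, Fin.val_one, Fin.val_two]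
  norm_num
  rw [classTheta_neg 2, classTheta_neg_one, classTheta_three, classTheta_four, classTheta_two]
  ring

theorem coeff_classTheta_one (n : ℕ) : coeff (3 * n) (classTheta 1) = 0 :=
  coeff_theta_eq_zero fun k h => by
    have := cast_sq3 1 k
    rw [h] at this
    push_cast at this
    ring_nf at this
    omega

theorem coeff_classTheta_one_sq (n : ℕ) : coeff (3 * n) (classTheta 1 ^ 2) = 0 := by
  rw [sq, classTheta, theta_mul (finiteFibers_sq3 1) (finiteFibers_sq3 1)]
  refine coeff_theta_eq_zero fun p h => ?_
  have := cast_sq3 1 p.1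
  have := cast_sq3 1 p.2
  zify at h
  rw [cast_sq3, cast_sq3] at h
  ring_nf at h
  omega

theorem classTheta_one_ne_zero : classTheta 1 ≠ 0 := fun h => by
  have h1 : coeff 1 (classTheta 1) = 0 := by simp [h]
  have := finiteFibers_sq3 1 1
  have : Nonempty {k // sq3 1 k = 1} := ⟨0, by simp [sq3]⟩
  rw [classTheta, coeff_theta, Nat.cast_eq_zero] at h1
  exact Nat.card_pos.ne' h1

/-! ### The operator `U` -/

section U

theorem coeff_U (f : ℚ⟦X⟧) (n : ℕ) : coeff n (U f) = coeff (3 * n) f := by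
  simp [U]

theorem U_add (f g : ℚ⟦X⟧) : U (f + g) = U f + U g := by
  ext n; simp [coeff_U]

theorem U_one : U 1 = 1 := by
  ext n; simp [coeff_U, coeff_one]

theorem U_expand_mul (g f : ℚ⟦X⟧) : U (expand 3 (by decide) g * f) = g * U f := by
  ext n
  rw [coeff_U, coeff_mul, coeff_mul]
  symm
  refine Finset.sum_of_injOn (fun p => (3 * p.1, 3 * p.2)) ?_ ?_ ?_ ?_
  · intro p _ q _ h
    simp only [Prod.mk.injEq] at h
    ext <;> omega
  · intro p hp
    simp only [Finset.mem_coe, Finset.HasAntidiagonal.mem_antidiagonal] at hp ⊢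
    omega
  · intro p hp h
    rw [coeff_expand_of_not_dvd, zero_mul]
    rintro ⟨k, hk⟩
    rw [Finset.HasAntidiagonal.mem_antidiagonal] at hp
    refine h ⟨(k, n - k), ?_, ?_⟩
    · simp only [Finset.mem_coe, Finset.HasAntidiagonal.mem_antidiagonal]
      omega
    · ext <;> dsimp only <;> omega
  · intro p _
    rw [coeff_expand_mul, coeff_U]

end U

/-! ### Passage to φ(-q) and relations between ξ and F -/

theorem rescale_neg_one_expand (f : ℚ⟦X⟧) {k : ℕ} (hk : k ≠ 0) (hodd : Odd k) :
    rescale (-1 : ℚ) (expand k hk f) = expand k hk (rescale (-1 : ℚ) f) := by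
  ext n
  rw [coeff_rescale]
  by_cases h : k ∣ n
  · obtain ⟨m, rfl⟩ := h
    rw [coeff_expand_mul, coeff_expand_mul, coeff_rescale, pow_mul, hodd.neg_one_pow]
  · rw [coeff_expand_of_not_dvd _ _ _ h, coeff_expand_of_not_dvd _ _ _ h, mul_zero]

/-- The part of `φ(-q)` whose exponents are the squares of the integers `1` modulo `3`. -/
def psiNeg : ℚ⟦X⟧ := rescale (-1 : ℚ) (classTheta 1)

theorem rescale_classTheta_zero :
    rescale (-1 : ℚ) (classTheta 0) = expand 9 (by decide) phiNeg := by
  rw [← expand_nine_phi, rescale_neg_one_expand _ _ (by decide), phiNeg]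

theorem phiNeg_eq : phiNeg = expand 9 (by decide) phiNeg + 2 * psiNeg := by
  rw [← rescale_classTheta_zero, phiNeg, psiNeg, phi_eq_classTheta, map_add, map_mul, map_ofNat]

theorem expand_three_phiNeg_pow_four : expand 3 (by decide) phiNeg ^ 4 =
    expand 9 (by decide) phiNeg ^ 4 + 8 * expand 9 (by decide) phiNeg * psiNeg ^ 3 := by
  have h := congrArg (rescale (-1 : ℚ)) expand_three_phi_pow_four
  rwa [map_pow, rescale_neg_one_expand _ _ (by decide), map_add, map_mul, map_mul, map_ofNat,
    map_pow, map_pow, rescale_classTheta_zero] at h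

theorem psiNeg_ne_zero : psiNeg ≠ 0 := by
  rw [psiNeg, Ne, map_eq_zero_iff _ (rescale_injective (by norm_num))]
  exact classTheta_one_ne_zero

theorem U_psiNeg : U psiNeg = 0 := by
  ext n
  rw [coeff_U, psiNeg, coeff_rescale, coeff_classTheta_one, mul_zero, map_zero]

theorem U_psiNeg_sq : U (psiNeg ^ 2) = 0 := by
  ext n
  rw [coeff_U, psiNeg, ← map_pow, coeff_rescale, coeff_classTheta_one_sq, mul_zero, map_zero]

theorem mul_inv_of_constantCoeff_eq_one {f : ℚ⟦X⟧} (h : constantCoeff f = 1) : f * f⁻¹ = 1 :=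
  PowerSeries.mul_inv_cancel f (by rw [h]; exact one_ne_zero)

theorem ne_zero_of_constantCoeff_eq_one {f : ℚ⟦X⟧} (h : constantCoeff f = 1) : f ≠ 0 := by
  rintro rfl
  simp at h

theorem phiNeg_ne_zero : phiNeg ≠ 0 := ne_zero_of_constantCoeff_eq_one constantCoeff_phiNeg

theorem xi_mul_phiNeg : xi * phiNeg = expand 9 (by decide) phiNeg := by
  rw [xi, mul_assoc, mul_comm phiNeg⁻¹, mul_inv_of_constantCoeff_eq_one constantCoeff_phiNeg,
    mul_one]

theorem F_mul_phiNeg : F * phiNeg = expand 3 (by decide) phiNeg := by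
  rw [F, mul_assoc, mul_comm phiNeg⁻¹, mul_inv_of_constantCoeff_eq_one constantCoeff_phiNeg,
    mul_one]

theorem expand_three_expand_three (f : ℚ⟦X⟧) :
    expand 3 (by decide) (expand 3 (by decide) f) = expand 9 (by decide) f :=
  (expand_mul 3 (by decide) 3 (by decide) f).symm

theorem constantCoeff_xi : constantCoeff xi = 1 := by
  simp [xi, constantCoeff_phiNeg]

/-- The relation of degree three between `F ^ 4` and `ξ`. -/
theorem F_pow_four : F ^ 4 = xi - 3 * xi ^ 2 + 3 * xi ^ 3 := by
  have h := expand_three_phiNeg_pow_four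
  have hp : 2 * psiNeg = phiNeg - expand 9 (by decide) phiNeg := by
    linear_combination -phiNeg_eq
  rw [← F_mul_phiNeg, ← xi_mul_phiNeg] at h
  rw [← xi_mul_phiNeg] at hp
  refine mul_right_cancel₀ (pow_ne_zero 4 phiNeg_ne_zero) ?_
  have h8 : 8 * psiNeg ^ 3 = (phiNeg - xi * phiNeg) ^ 3 := by rw [← hp]; ring
  linear_combination h + xi * phiNeg * h8

theorem expand_F_mul : expand 3 (by decide) F * expand 3 (by decide) phiNeg =
    expand 9 (by decide) phiNeg := by
  rw [← map_mul, F_mul_phiNeg, expand_three_expand_three]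

theorem xi_eq_mul : xi = expand 3 (by decide) F * F := by
  refine mul_right_cancel₀ phiNeg_ne_zero ?_
  rw [mul_assoc, F_mul_phiNeg, expand_F_mul, xi_mul_phiNeg]

theorem xi_ne_zero : xi ≠ 0 := ne_zero_of_constantCoeff_eq_one constantCoeff_xi

/-- The modular equation relating `ξ(q)` and `F(q ^ 3)`. -/
theorem xi_pow_three :
    xi ^ 3 = expand 3 (by decide) (F ^ 4) * (3 * xi ^ 2 - 3 * xi + 1) := by
  refine mul_right_cancel₀ xi_ne_zero ?_
  rw [map_pow]
  linear_combination congrArg (· ^ 4) xi_eq_mul + expand 3 (by decide) F ^ 4 * F_pow_four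

/-- The quotient of the two parts of `φ(-q)` in its dissection modulo `3`. -/
def dissectionQuotient : ℚ⟦X⟧ :=
  expand 3 (by decide) (-2 * (expand 3 (by decide) phiNeg)⁻¹) * psiNeg

theorem xi_mul_one_sub : xi * (1 - dissectionQuotient) = 1 := by
  refine mul_right_cancel₀ phiNeg_ne_zero ?_
  have h : expand 9 (by decide) phiNeg *
      expand 3 (by decide) (expand 3 (by decide) phiNeg)⁻¹ = 1 := by
    rw [← expand_three_expand_three, ← map_mul, mul_inv_of_constantCoeff_eq_one, map_one]
    rw [constantCoeff_expand, constantCoeff_phiNeg]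
  rw [dissectionQuotient, map_mul, map_neg, map_ofNat]
  linear_combination (1 + 2 * expand 3 (by decide) (expand 3 (by decide) phiNeg)⁻¹ * psiNeg) *
    xi_mul_phiNeg - phiNeg_eq + 2 * psiNeg * h

theorem U_dissectionQuotient : U dissectionQuotient = 0 := by
  rw [dissectionQuotient, U_expand_mul, U_psiNeg, mul_zero]

theorem U_dissectionQuotient_sq : U (dissectionQuotient ^ 2) = 0 := by
  rw [dissectionQuotient, mul_pow, ← map_pow, U_expand_mul, U_psiNeg_sq, mul_zero]

/-- Put d = 1 - 1/ξ in 1 - d³ and compare with the modular equation. -/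
theorem expand_F_pow_four_mul :
    expand 3 (by decide) (F ^ 4) * (1 - dissectionQuotient ^ 3) = 1 := by
  refine mul_left_cancel₀ (pow_ne_zero 3 xi_ne_zero) ?_
  have h := xi_mul_one_sub
  have h1 : xi * dissectionQuotient = xi - 1 := by linear_combination -h
  have h3 : xi ^ 3 * dissectionQuotient ^ 3 = (xi - 1) ^ 3 := by rw [← mul_pow, h1]
  linear_combination -expand 3 (by decide) (F ^ 4) * h3 - xi_pow_three

/-- This is 1/(1 - d) = (1 + d + d²)/(1 - d³), the dissection of ξ by exponents modulo 3. -/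
theorem xi_eq_dissection : xi = expand 3 (by decide) (F ^ 4) *
    (1 + dissectionQuotient + dissectionQuotient ^ 2) := by
  linear_combination -xi * expand_F_pow_four_mul + expand 3 (by decide) (F ^ 4) *
    (1 + dissectionQuotient + dissectionQuotient ^ 2) * xi_mul_one_sub

theorem U_expand (g : ℚ⟦X⟧) : U (expand 3 (by decide) g) = g := by
  rw [← mul_one (expand 3 _ g), U_expand_mul, U_one, mul_one]

theorem U_xi : U xi = F ^ 4 := by
  rw [xi_eq_dissection, U_expand_mul, U_add, U_add, U_one, U_dissectionQuotient,
    U_dissectionQuotient_sq, add_zero, add_zero, mul_one]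

theorem U_xi_sq : U (xi ^ 2) = 3 * (F ^ 4) ^ 2 - 2 * F ^ 4 := by
  -- Write G = F(q^3)^4, expand G²(1 + d + d²)² and reduce by Gd³ = G - 1.
  have h : xi ^ 2 = expand 3 (by decide) (3 * (F ^ 4) ^ 2 - 2 * F ^ 4) +
      (expand 3 (by decide) (3 * (F ^ 4) ^ 2 - F ^ 4) * dissectionQuotient +
        expand 3 (by decide) (3 * (F ^ 4) ^ 2) * dissectionQuotient ^ 2) := by
    simp only [map_sub, map_mul, map_pow _ (F ^ 4), map_ofNat]
    have h := expand_F_pow_four_mul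
    rw [xi_eq_dissection]
    linear_combination -expand 3 (by decide) (F ^ 4) * (2 + dissectionQuotient) * h
  rw [h, U_add, U_add, U_expand_mul, U_expand_mul, U_expand, U_dissectionQuotient,
    U_dissectionQuotient_sq, mul_zero, mul_zero, add_zero, add_zero]

theorem U_xi_pow_add_three (i : ℕ) : U (xi ^ (i + 3)) =
    F ^ 4 * (3 * U (xi ^ (i + 2)) - 3 * U (xi ^ (i + 1)) + U (xi ^ i)) := by
  -- The negative term is moved to the left so that additivity of `U` suffices.
  have h : xi ^ (i + 3) + expand 3 (by decide) (3 * F ^ 4) * xi ^ (i + 1) =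
      expand 3 (by decide) (3 * F ^ 4) * xi ^ (i + 2) + expand 3 (by decide) (F ^ 4) * xi ^ i := by
    simp only [map_mul, map_ofNat]
    linear_combination xi ^ i * xi_pow_three
  have hU := congrArg U h
  rw [U_add, U_add, U_expand_mul, U_expand_mul, U_expand_mul] at hU
  linear_combination hU

/-! ### Polynomials in ξ -/

section Polynomial

open Polynomial (aeval)

theorem aeval_F_pow_four :
    aeval xi (.X - 3 * .X ^ 2 + 3 * .X ^ 3 : Polynomial ℤ) = F ^ 4 := by
  rw [F_pow_four]
  simp [map_ofNat]

/-- The exponent `(i + 2) / 3` is ⌈i/3⌉; the factor F^4 in the recursion supplies the additional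
`X`. -/
theorem exists_polynomial_U_xi_pow (i : ℕ) :
    ∃ P : Polynomial ℤ, U (xi ^ i) = aeval xi P ∧ Polynomial.X ^ ((i + 2) / 3) ∣ P := by
  induction i using Nat.strong_induction_on with
  | _ i ih =>
    have hp : Polynomial.X ∣ (.X - 3 * .X ^ 2 + 3 * .X ^ 3 : Polynomial ℤ) :=
      ⟨1 - 3 * .X + 3 * .X ^ 2, by ring⟩
    match i, ih with
    | 0, _ => exact ⟨1, by simp [U_one], by simp⟩
    | 1, _ => exact ⟨_, by rw [pow_one, U_xi, ← aeval_F_pow_four], by simpa using hp⟩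
    | 2, _ =>
      refine ⟨3 * (.X - 3 * .X ^ 2 + 3 * .X ^ 3) ^ 2 - 2 * (.X - 3 * .X ^ 2 + 3 * .X ^ 3), ?_, ?_⟩
      · rw [U_xi_sq, ← aeval_F_pow_four]
        simp only [map_sub (aeval (R := ℤ) xi), map_mul (aeval (R := ℤ) xi),
          map_pow (aeval (R := ℤ) xi) _ 2, map_ofNat (aeval (R := ℤ) xi)]
      · rw [show (2 + 2) / 3 = 1 from rfl, pow_one]
        exact ((hp.pow two_ne_zero).mul_left _).sub (hp.mul_left _)
    | i + 3, ih =>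
      obtain ⟨P, hP, hP'⟩ := ih i (by omega)
      obtain ⟨Q, hQ, hQ'⟩ := ih (i + 1) (by omega)
      obtain ⟨R, hR, hR'⟩ := ih (i + 2) (by omega)
      refine ⟨(.X - 3 * .X ^ 2 + 3 * .X ^ 3) * (3 * R - 3 * Q + P), ?_, ?_⟩
      · rw [U_xi_pow_add_three, hP, hQ, hR, map_mul, aeval_F_pow_four]
        simp [map_ofNat]
      · rw [show (i + 3 + 2) / 3 = (i + 2) / 3 + 1 by omega, pow_succ']
        refine mul_dvd_mul hp (dvd_add (dvd_sub ?_ ?_) hP')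
        · exact ((pow_dvd_pow _ (by omega)).trans hR').mul_left _
        · exact ((pow_dvd_pow _ (by omega)).trans hQ').mul_left _

theorem expand_xi_mul_gamma : expand 3 (by decide) xi * gamma = xi := by
  have h : expand 9 (by decide) F * (expand 9 (by decide) F)⁻¹ = 1 :=
    mul_inv_of_constantCoeff_eq_one constantCoeff_expand_F
  rw [gamma, xi_eq_mul, map_mul, expand_three_expand_three]
  linear_combination F * expand 3 (by decide) F * h

theorem xi_mul_U_gamma_mul (i : ℕ) : xi * U (gamma * xi ^ i) = U (xi ^ (i + 1)) := by
  rw [← U_expand_mul, ← mul_assoc, expand_xi_mul_gamma, pow_succ']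

theorem xi_ne_one : xi ≠ 1 := fun h => by
  have h1 := xi_mul_phiNeg
  have h2 := phiNeg_eq
  rw [h, one_mul] at h1
  rw [← h1, left_eq_add] at h2
  have h3 := congrArg constantCoeff ((mul_eq_zero.1 h2).resolve_right psiNeg_ne_zero)
  rw [map_ofNat, map_zero] at h3
  norm_num at h3

/-- A power series with constant coefficient zero is transcendental unless it vanishes. -/
theorem aeval_injective_of_constantCoeff_eq_zero {f : ℚ⟦X⟧} (h0 : constantCoeff f = 0)
    (hf : f ≠ 0) : Function.Injective (aeval (R := ℤ) f) := by
  rw [injective_iff_map_eq_zero]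
  intro P hP
  by_contra hP0
  obtain ⟨Q, hPQ, hQ⟩ := Polynomial.exists_eq_pow_rootMultiplicity_mul_and_not_dvd P hP0 0
  rw [map_zero, sub_zero] at hPQ hQ
  rw [Polynomial.X_dvd_iff] at hQ
  rw [hPQ, map_mul, map_pow, Polynomial.aeval_X] at hP
  have hQ1 := (mul_eq_zero.1 hP).resolve_left (pow_ne_zero _ hf)
  rw [← Polynomial.divX_mul_X_add Q, map_add, map_mul, Polynomial.aeval_X] at hQ1
  have hQ2 := congrArg constantCoeff hQ1
  simp [h0] at hQ2
  exact hQ hQ2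

/-- Shifting the variable by 1 replaces ξ by ξ - 1, which is nonzero with constant term 0. -/
theorem aeval_xi_injective : Function.Injective (aeval (R := ℤ) xi) := by
  have h := aeval_injective_of_constantCoeff_eq_zero (f := xi - 1)
    (by rw [map_sub, constantCoeff_xi, map_one, sub_self]) (sub_ne_zero.2 xi_ne_one)
  intro P Q hPQ
  have hc (R : Polynomial ℤ) : aeval (xi - 1) (R.comp (.X + 1)) = aeval xi R := by
    simp [Polynomial.aeval_comp]
  rw [← hc, ← hc] at hPQ
  have := congrArg (fun R : Polynomial ℤ => R.comp (.X - 1)) (h hPQ)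
  simpa [Polynomial.comp_assoc] using this

end Polynomial

end RamanujanTheta

end

theorem theorem2p1 (i : ℕ) :
    (∃ P : Polynomial ℤ,
      RamanujanTheta.U (RamanujanTheta.xi ^ i) = Polynomial.aeval RamanujanTheta.xi P) ∧
    (∃ Q : Polynomial ℤ,
      RamanujanTheta.U (RamanujanTheta.gamma * RamanujanTheta.xi ^ i) =
        Polynomial.aeval RamanujanTheta.xi Q) ∧
    (∀ P : Polynomial ℤ,
      RamanujanTheta.U (RamanujanTheta.xi ^ i) = Polynomial.aeval RamanujanTheta.xi P →
        ∀ j : ℕ, j < ⌈(i : ℚ) / 3⌉₊ → P.coeff j = 0) := by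
  obtain ⟨P, hP, hdvd⟩ := RamanujanTheta.exists_polynomial_U_xi_pow i
  refine ⟨⟨P, hP⟩, ?_, fun P' hP' j hj => ?_⟩
  · obtain ⟨Q, hQ, hQdvd⟩ := RamanujanTheta.exists_polynomial_U_xi_pow (i + 1)
    -- Since i + 1 > 0, at least one factor `X` is available to cancel ξ.
    obtain ⟨R, rfl⟩ := (dvd_pow_self _ (by omega)).trans hQdvd
    refine ⟨R, mul_left_cancel₀ RamanujanTheta.xi_ne_zero ?_⟩
    rw [RamanujanTheta.xi_mul_U_gamma_mul, hQ, map_mul, Polynomial.aeval_X]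
  · rw [RamanujanTheta.aeval_xi_injective (hP'.symm.trans hP)]
    refine Polynomial.X_pow_dvd_iff.1 hdvd j ?_
    rw [Nat.lt_ceil, lt_div_iff₀ (by norm_num)] at hj
    have : j * 3 < i := by exact_mod_cast hj
    omega
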